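/- Let $G$ be a (finite-dimensional, real) Lie group with Lie algebra $\mathcal G$, and let $U$ be a strongly continuous unitary representation of $G$ on a complex Hilbert space $\mathcal H$. Let $\mathcal D^\infty(U)$ be the space of $\phi\in\mathcal H$ for which $g\mapsto U(g)\phi$ is a $C^\infty$ map $G\to\mathcal H$. For $x\in\mathcal G$ put $dU(x)\phi=\frac{d}{dt}U(\exp tx)\phi\,|_{t=0}$ for $\phi\in\mathcal D^\infty(U)$; this extends uniquely to a representation $dU$ on $\mathcal D^\infty(U)$ of the complex universal enveloping algebra $\mathcal E(\mathcal G)$ of $\mathcal G_{\mathbb C}$. Let $\mathcal M=dU(\mathcal E(\mathcal G))$ be its image, an algebra of linear operators $\mathcal D^\infty(U)\to\mathcal D^\infty(U)$. Let $\mathcal T_1(\mathcal M)$ be the set of trace class operators $\hat T$ on $\mathcal H$ such that $\hat T\mathcal H\subset\mathcal D^\infty(U)$, $\hat T^*\mathcal H\subset\mathcal D^\infty(U)$, and $\hat A\hat T$, $\hat A\hat T^*$ are trace class for all $\hat A\in\mathcal M$. The state space $\mathcal E_S(\mathcal M)$ is the set of positive $\hat\rho\in\mathcal T_1(\mathcal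 M)$ with $\mathrm{Tr}\,\hat\rho=1$. For $\hat A\in\mathcal M$ define $a_Q(\hat\rho)=\mathrm{Tr}(\hat A\hat\rho)$ on $\mathcal E_S(\mathcal M)$, and give $\mathcal E_S(\mathcal M)$ the weak topology, the coarsest one in which all functions $a_Q$, $\hat A\in\mathcal M$, are continuous. Let $\hat A\in\mathcal M$ be essentially self-adjoint on $\mathcal D^\infty(U)$, let $W$ be a non-empty open subset of $\mathcal E_S(\mathcal M)$ and let $k$ be a real number. If $a_Q(\hat\rho)=k$ for all $\hat\rho\in W$, then $\hat A=k\hat I$ on $\mathcal D^\infty(U)$; consequently $a_Q(\hat\rho)=k$ for all $\hat\rho\in\mathcal E_S(\mathcal M)$. That is, if the quantum real number $a_Q$ equals a standard real number to some non-empty open extent $W$, then it equals that number to full extent. -/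

import Mathlib

open scoped Manifold ContDiff TensorProduct InnerProductSpace
open Set

noncomputable section

namespace QReal

/-! ### Unitary representations and smooth vectors -/

/-- A smooth real Lie group has the finite smoothness for which Mathlib builds its Lie algebra. -/
instance instLieGroupMinSmoothness {E : Type*} [NormedAddCommGroup E] [NormedSpace ℝ E]
    {G : Type*} [TopologicalSpace G] [ChartedSpace E G] [Group G] [LieGroup 𝓘(ℝ, E) ∞ G] :
    LieGroup 𝓘(ℝ, E) (minSmoothness ℝ 3) G :=
  LieGroup.of_le (m := minSmoothness ℝ 3) (n := ∞) (by
    rw [minSmoothness_of_isRCLikeNormedField]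
    exact WithTop.coe_le_coe.2 (le_top : (3 : ℕ∞) ≤ ⊤))

/-- A (strongly continuous) unitary representation of a topological group `G` on `H`. -/
structure UnitaryRep (G H : Type*) [Group G] [TopologicalSpace G]
    [NormedAddCommGroup H] [InnerProductSpace ℂ H] [CompleteSpace H] where
  /-- the homomorphism into the unitary group of `H` -/
  toHom : G →* unitary (H →L[ℂ] H)
  /-- each orbit map is continuous -/
  continuous_orbit : ∀ φ : H, Continuous fun g : G => (toHom g : H →L[ℂ] H) φ

namespace UnitaryRep

variable {E : Type*} [NormedAddCommGroup E] [NormedSpace ℝ E]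
  {G : Type*} [TopologicalSpace G] [ChartedSpace E G] [Group G]
  {H : Type*} [NormedAddCommGroup H] [InnerProductSpace ℂ H] [CompleteSpace H]

/-- The orbit map `g ↦ U(g) φ`. -/
def orbit (U : UnitaryRep G H) (φ : H) (g : G) : H := (U.toHom g : H →L[ℂ] H) φ

lemma orbit_mul (U : UnitaryRep G H) (φ : H) (g h : G) :
    U.orbit φ (g * h) = (U.toHom g : H →L[ℂ] H) (U.orbit φ h) := by
  simp [orbit]

lemma orbit_one (U : UnitaryRep G H) (φ : H) : U.orbit φ 1 = φ := by
  simp [orbit]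

/-- The space `𝓓^∞(U)` of smooth vectors: the orbit map is a smooth map from the manifold `G`
to the (real) Banach space `H`. -/
def smoothVectors (E : Type*) [NormedAddCommGroup E] [NormedSpace ℝ E] [ChartedSpace E G]
    (U : UnitaryRep G H) : Submodule ℂ H where
  carrier := {φ | ContMDiff 𝓘(ℝ, E) 𝓘(ℝ, H) ∞ (U.orbit φ)}
  add_mem' {φ ψ} hφ hψ := by
    have : U.orbit (φ + ψ) = fun g => U.orbit φ g + U.orbit ψ g := by
      funext g; simp [orbit]
    simp only [mem_ofPred_eq, this]
    exact ContMDiff.add hφ hψ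
  zero_mem' := by
    have : U.orbit (0 : H) = fun _ => 0 := by funext g; simp [orbit]
    simp only [mem_ofPred_eq, this]
    exact contMDiff_const
  smul_mem' c φ hφ := by
    have : U.orbit (c • φ) = (((c • ContinuousLinearMap.id ℂ H).restrictScalars ℝ) : H →L[ℝ] H) ∘
        U.orbit φ := by
      funext g; simp [orbit]
    simp only [mem_ofPred_eq, this]
    exact (ContinuousLinearMap.contMDiff _).comp hφ

lemma mem_smoothVectors {U : UnitaryRep G H} {φ : H} :
    φ ∈ U.smoothVectors E ↔ ContMDiff 𝓘(ℝ, E) 𝓘(ℝ, H) ∞ (U.orbit φ) := Iff.rfl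

/-- The vector `dU(x) φ`: the derivative at the identity of `g ↦ U(g) φ` in the direction `x`. -/
def deriv (U : UnitaryRep G H) (x : GroupLieAlgebra 𝓘(ℝ, E) G) (φ : H) : H :=
  (mfderiv 𝓘(ℝ, E) 𝓘(ℝ, H) (U.orbit φ) (1 : G) x : H)

lemma mdifferentiable_orbit (U : UnitaryRep G H) {φ : H} (hφ : φ ∈ U.smoothVectors E) (g : G) :
    MDifferentiableAt 𝓘(ℝ, E) 𝓘(ℝ, H) (U.orbit φ) g :=
  (mem_smoothVectors.1 hφ).mdifferentiable (by simp) g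

/-- `dU(x) φ = d/dt U(γ t) φ` at `t = 0` for every curve `γ` through the identity with velocity `x`,
in particular for `γ t = exp (t x)`. -/
lemma hasDerivAt_deriv (U : UnitaryRep G H) {φ : H} (hφ : φ ∈ U.smoothVectors E)
    (x : GroupLieAlgebra 𝓘(ℝ, E) G) (γ : ℝ → G) (h1 : γ 0 = 1)
    (hγ : HasMFDerivAt 𝓘(ℝ, ℝ) 𝓘(ℝ, E) γ 0
      ((ContinuousLinearMap.toSpanSingleton ℝ (show E from x) : ℝ →L[ℝ] E))) :
    HasDerivAt (fun t => (U.toHom (γ t) : H →L[ℂ] H) φ) (U.deriv x φ) 0 := by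
  have h2 : HasMFDerivAt 𝓘(ℝ, E) 𝓘(ℝ, H) (U.orbit φ) (γ 0)
      (mfderiv 𝓘(ℝ, E) 𝓘(ℝ, H) (U.orbit φ) (γ 0)) :=
    (U.mdifferentiable_orbit hφ (γ 0)).hasMFDerivAt
  have h3 : HasFDerivAt (𝕜 := ℝ) (E := ℝ) (F := H) (U.orbit φ ∘ γ)
      ((show E →L[ℝ] H from mfderiv 𝓘(ℝ, E) 𝓘(ℝ, H) (U.orbit φ) (γ 0)).comp
        (ContinuousLinearMap.toSpanSingleton ℝ (show E from x))) 0 := (h2.comp 0 hγ).hasFDerivAt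
  have h4 : HasDerivAt (U.orbit φ ∘ γ)
      ((show E →L[ℝ] H from mfderiv 𝓘(ℝ, E) 𝓘(ℝ, H) (U.orbit φ) (γ 0))
        ((1 : ℝ) • (show E from x))) 0 := h3.hasDerivAt
  rw [one_smul, h1] at h4
  exact h4

lemma orbit_deriv [LieGroup 𝓘(ℝ, E) ∞ G] (U : UnitaryRep G H) {φ : H}
    (hφ : φ ∈ U.smoothVectors E) (x : GroupLieAlgebra 𝓘(ℝ, E) G) (g : G) :
    U.orbit (U.deriv x φ) g =
      (mfderiv 𝓘(ℝ, E) 𝓘(ℝ, H) (U.orbit φ) g (mulInvariantVectorField x g) : H) := by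
  have hL : MDifferentiableAt 𝓘(ℝ, E) 𝓘(ℝ, E) (fun h : G => g * h) 1 :=
    (contMDiff_mul_left (I := 𝓘(ℝ, E)) (n := ∞)).mdifferentiable (by simp) 1
  have e1 : U.orbit φ ∘ (fun h : G => g * h) =
      ((U.toHom g : H →L[ℂ] H).restrictScalars ℝ) ∘ U.orbit φ := by
    funext h; simp [orbit_mul]
  have d1 := mfderiv_comp (I := 𝓘(ℝ, E)) (I' := 𝓘(ℝ, E)) (I'' := 𝓘(ℝ, H)) (1 : G)
    (U.mdifferentiable_orbit hφ (g * 1)) hL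
  have d2 := mfderiv_comp (I := 𝓘(ℝ, E)) (I' := 𝓘(ℝ, H)) (I'' := 𝓘(ℝ, H)) (1 : G)
    (((U.toHom g : H →L[ℂ] H).restrictScalars ℝ).mdifferentiableAt)
    (U.mdifferentiable_orbit hφ 1)
  rw [e1, d2] at d1
  have d3 : (mfderiv 𝓘(ℝ, H) 𝓘(ℝ, H) ((U.toHom g : H →L[ℂ] H).restrictScalars ℝ)
      (U.orbit φ 1) : H →L[ℝ] H) (U.deriv x φ) =
      (mfderiv 𝓘(ℝ, E) 𝓘(ℝ, H) (U.orbit φ) (g * 1) : E →L[ℝ] H)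
        ((mfderiv 𝓘(ℝ, E) 𝓘(ℝ, E) (fun h : G => g * h) 1 : E →L[ℝ] E) x) :=
    congrArg (fun L : E →L[ℝ] H => L x) d1
  rw [ContinuousLinearMap.mfderiv_eq, mul_one] at d3
  exact d3

set_option linter.unusedSectionVars false in
lemma inTangentCoordinates_const [LieGroup 𝓘(ℝ, E) ∞ G] (p : G) (k : G → H)
    (ϕ : G → E →L[ℝ] H) (g₀ g : G) :
    have : IsManifold 𝓘(ℝ, E) 1 G := IsManifold.of_le (n := ∞) (by simp)
    inTangentCoordinates 𝓘(ℝ, E) 𝓘(ℝ, H) (fun _ : G => p) k ϕ g₀ g = ϕ g := by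
  intro this
  have h1 : p ∈ (chartAt E p).source := mem_chart_source E _
  rw [inTangentCoordinates_eq (I := 𝓘(ℝ, E)) (I' := 𝓘(ℝ, H)) (fun _ : G => p) k ϕ
    (x₀ := g₀) (x := g) h1 (mem_univ _), TangentBundle.coordChange_model_space]
  ext v
  simp only [ContinuousLinearMap.comp_apply, one_apply_eq_self]
  rw [(tangentBundleCore 𝓘(ℝ, E) G).coordChange_self (achart E p) p h1]

lemma deriv_mem [LieGroup 𝓘(ℝ, E) ∞ G] (U : UnitaryRep G H) {φ : H}
    (hφ : φ ∈ U.smoothVectors E) (x : GroupLieAlgebra 𝓘(ℝ, E) G) :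
    U.deriv x φ ∈ U.smoothVectors E := by
  have : IsManifold 𝓘(ℝ, E) 1 G := IsManifold.of_le (n := ∞) (by simp)
  rw [mem_smoothVectors] at hφ ⊢
  intro g₀
  have hF : ContMDiffAt (𝓘(ℝ, E).prod 𝓘(ℝ, E)) 𝓘(ℝ, H) ∞
      (Function.uncurry fun g h : G => U.orbit φ (g * h)) (g₀, (1 : G)) :=
    (hφ.comp (contMDiff_mul 𝓘(ℝ, E) ∞)) (g₀, (1 : G))
  have key := ContMDiffAt.mfderiv_apply (m := ∞) (J := 𝓘(ℝ, E)) (J' := 𝓘(ℝ, E)) (I := 𝓘(ℝ, E))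
    (I' := 𝓘(ℝ, H)) (x₀ := g₀)
    (fun g h : G => U.orbit φ (g * h)) (fun _ => (1 : G)) id (fun _ => (show E from x)) hF
    contMDiffAt_const contMDiffAt_id contMDiffAt_const (by simp)
  refine key.congr_of_eventuallyEq (Filter.Eventually.of_forall fun g => ?_)
  refine Eq.trans ?_ (congrArg (fun L : E →L[ℝ] H => L x)
    (inTangentCoordinates_const (E := E) (1 : G) (fun g => U.orbit φ (g * 1))
      (fun g => mfderiv 𝓘(ℝ, E) 𝓘(ℝ, H) (fun h : G => U.orbit φ (g * h)) 1) g₀ g)).symm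
  have e1 : (fun h : G => U.orbit φ (g * h)) =
      ((U.toHom g : H →L[ℂ] H).restrictScalars ℝ) ∘ U.orbit φ := by
    funext h; simp [orbit_mul]
  have d2 := mfderiv_comp (I := 𝓘(ℝ, E)) (I' := 𝓘(ℝ, H)) (I'' := 𝓘(ℝ, H)) (1 : G)
    (((U.toHom g : H →L[ℂ] H).restrictScalars ℝ).mdifferentiableAt)
    (U.mdifferentiable_orbit hφ 1)
  rw [← e1, ContinuousLinearMap.mfderiv_eq] at d2
  exact (congrArg (fun L : E →L[ℝ] H => L x) d2).symm

open VectorField in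
/-- `dU` respects Lie brackets. -/
lemma deriv_lie [FiniteDimensional ℝ E] [LieGroup 𝓘(ℝ, E) ∞ G] (U : UnitaryRep G H) {φ : H}
    (hφ : φ ∈ U.smoothVectors E) (x y : GroupLieAlgebra 𝓘(ℝ, E) G) :
    U.deriv ⁅x, y⁆ φ = U.deriv x (U.deriv y φ) - U.deriv y (U.deriv x φ) := by
  have : CompleteSpace E := FiniteDimensional.complete ℝ E
  have : IsManifold 𝓘(ℝ, E) 1 G := IsManifold.of_le (n := ∞) (by simp)
  have : IsManifold 𝓘(ℝ, E) 2 G :=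
    IsManifold.of_le (n := ∞) (WithTop.coe_le_coe.2 (le_top : (2 : ℕ∞) ≤ ⊤))
  set χ := extChartAt 𝓘(ℝ, E) (1 : G) with hχ
  set c : E := χ 1 with hc
  have hct : c ∈ χ.target := mem_extChartAt_target _
  have hcs : χ.symm c = 1 := extChartAt_to_inv _
  -- the two vector fields in the chart
  let vf : GroupLieAlgebra 𝓘(ℝ, E) G → E → E := fun v =>
    mpullbackWithin 𝓘(ℝ, E) 𝓘(ℝ, E) χ.symm (mulInvariantVectorField v) (range 𝓘(ℝ, E))
  have hvf : ∀ v, DifferentiableAt ℝ (vf v) c := by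
    intro v
    have := MDifferentiableWithinAt.differentiableWithinAt_mpullbackWithin_vectorField
      ((mdifferentiableAt_mulInvariantVectorField (I := 𝓘(ℝ, E)) v
        (g := (1 : G))).mdifferentiableWithinAt (s := univ))
    simp only [preimage_univ, univ_inter, modelWithCornersSelf_coe, range_id] at this
    simp only [vf, modelWithCornersSelf_coe, range_id]
    exact differentiableWithinAt_univ.1 this
  -- derivatives of orbit maps in the chart
  let dW : E → E →L[ℝ] E := fun z =>
    mfderivWithin 𝓘(ℝ, E) 𝓘(ℝ, E) χ.symm (range 𝓘(ℝ, E)) z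
  have hsm : ∀ {ψ : H}, ψ ∈ U.smoothVectors E → ContDiffAt ℝ 2 (U.orbit ψ ∘ χ.symm) c := by
    intro ψ hψ
    have h1 : ContMDiffWithinAt 𝓘(ℝ, E) 𝓘(ℝ, E) ∞ χ.symm (range 𝓘(ℝ, E)) c :=
      contMDiffWithinAt_extChartAt_symm_range _ hct
    rw [modelWithCornersSelf_coe, range_id, contMDiffWithinAt_univ] at h1
    have h2 : ContMDiffAt 𝓘(ℝ, E) 𝓘(ℝ, H) ∞ (U.orbit ψ ∘ χ.symm) c :=
      (mem_smoothVectors.1 hψ (χ.symm c)).comp c h1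
    exact h2.contDiffAt.of_le (WithTop.coe_le_coe.2 (le_top : (2 : ℕ∞) ≤ ⊤))
  let dF : H → G → E →L[ℝ] H := fun ψ g => mfderiv 𝓘(ℝ, E) 𝓘(ℝ, H) (U.orbit ψ) g
  have hchart : ∀ {ψ : H}, ψ ∈ U.smoothVectors E → ∀ z ∈ χ.target, ∀ w : E,
      fderiv ℝ (U.orbit ψ ∘ χ.symm) z w = dF ψ (χ.symm z) (dW z w) := by
    intro ψ hψ z hz w
    have h1 : MDifferentiableWithinAt 𝓘(ℝ, E) 𝓘(ℝ, E) χ.symm (range 𝓘(ℝ, E)) z :=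
      mdifferentiableWithinAt_extChartAt_symm hz
    simp only [dW, modelWithCornersSelf_coe, range_id, mdifferentiableWithinAt_univ,
      mfderivWithin_univ] at h1 ⊢
    have h2 := mfderiv_comp z (U.mdifferentiable_orbit hψ (χ.symm z)) h1
    rw [mfderiv_eq_fderiv] at h2
    exact congrArg (fun L : E →L[ℝ] H => L w) h2
  have hfield : ∀ {ψ : H}, ψ ∈ U.smoothVectors E → ∀ v, ∀ z ∈ χ.target,
      fderiv ℝ (U.orbit ψ ∘ χ.symm) z (vf v z) = (U.orbit (U.deriv v ψ) ∘ χ.symm) z := by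
    intro ψ hψ v z hz
    have h1 : (mfderivWithin 𝓘(ℝ, E) 𝓘(ℝ, E) χ.symm (range 𝓘(ℝ, E)) z).IsInvertible :=
      isInvertible_mfderivWithin_extChartAt_symm hz
    have h2 : dW z (vf v z) =
        mulInvariantVectorField v (χ.symm z) := h1.self_apply_inverse _
    rw [hchart hψ z hz, h2, Function.comp_apply, U.orbit_deriv hψ]
    rfl
  have hbr : dW c (lieBracket ℝ (vf x) (vf y) c) =
      ((⁅x, y⁆ : GroupLieAlgebra 𝓘(ℝ, E) G) : GroupLieAlgebra 𝓘(ℝ, E) G) := by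
    let dχ : E →L[ℝ] E := mfderiv 𝓘(ℝ, E) 𝓘(ℝ, E) χ 1
    have h1 : dχ.inverse = dW c :=
      ContinuousLinearMap.inverse_eq
        (mfderiv_extChartAt_comp_mfderivWithin_extChartAt_symm' (mem_extChartAt_source _))
        (mfderivWithin_extChartAt_symm_comp_mfderiv_extChartAt' (mem_extChartAt_source _))
    have h2 : (⁅x, y⁆ : GroupLieAlgebra 𝓘(ℝ, E) G) =
        dχ.inverse (lieBracketWithin ℝ (vf x) (vf y)
          (χ.symm ⁻¹' univ ∩ range 𝓘(ℝ, E)) c) := rfl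
    rw [preimage_univ, univ_inter, modelWithCornersSelf_coe, range_id, lieBracketWithin_univ,
      h1] at h2
    exact h2.symm
  have h0 := fderiv_apply_lieBracket (hsm hφ) (n := 2)
    (by rw [minSmoothness_of_isRCLikeNormedField]) (hvf y) (hvf x)
  have hev : ∀ v, (fun z => fderiv ℝ (U.orbit φ ∘ χ.symm) z (vf v z)) =ᶠ[nhds c]
      (U.orbit (U.deriv v φ) ∘ χ.symm) := fun v => by
    filter_upwards [extChartAt_target_mem_nhds (I := 𝓘(ℝ, E)) (1 : G)] with z hz
    exact hfield hφ v z hz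
  rw [(hev x).fderiv_eq, (hev y).fderiv_eq, hfield (U.deriv_mem hφ y) _ _ hct,
    hfield (U.deriv_mem hφ x) _ _ hct, hchart hφ _ hct, hbr] at h0
  simp only [Function.comp_apply, hcs, orbit_one] at h0
  exact h0

/-! ### The infinitesimal representation of the enveloping algebra -/

lemma deriv_add_vec (U : UnitaryRep G H) {φ ψ : H} (hφ : φ ∈ U.smoothVectors E)
    (hψ : ψ ∈ U.smoothVectors E) (x : GroupLieAlgebra 𝓘(ℝ, E) G) :
    U.deriv x (φ + ψ) = U.deriv x φ + U.deriv x ψ := by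
  have h : U.orbit (φ + ψ) = U.orbit φ + U.orbit ψ := by
    funext g; simp [orbit]
  have h1 := mfderiv_add (U.mdifferentiable_orbit hφ 1) (U.mdifferentiable_orbit hψ 1)
  rw [← h] at h1
  exact congrArg (fun L : E →L[ℝ] H => L x) h1

lemma deriv_smul_vec (U : UnitaryRep G H) {φ : H} (hφ : φ ∈ U.smoothVectors E) (a : ℂ)
    (x : GroupLieAlgebra 𝓘(ℝ, E) G) : U.deriv x (a • φ) = a • U.deriv x φ := by
  have h : U.orbit (a • φ) = ((a • ContinuousLinearMap.id ℂ H).restrictScalars ℝ : H →L[ℝ] H) ∘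
      U.orbit φ := by
    funext g; simp [orbit]
  have h1 := mfderiv_comp (I := 𝓘(ℝ, E)) (I' := 𝓘(ℝ, H)) (I'' := 𝓘(ℝ, H)) (1 : G)
    (((a • ContinuousLinearMap.id ℂ H).restrictScalars ℝ : H →L[ℝ] H).mdifferentiableAt)
    (U.mdifferentiable_orbit hφ 1)
  rw [← h, ContinuousLinearMap.mfderiv_eq] at h1
  exact congrArg (fun L : E →L[ℝ] H => L x) h1

lemma deriv_add_dir (U : UnitaryRep G H) (x y : GroupLieAlgebra 𝓘(ℝ, E) G) (φ : H) :
    U.deriv (x + y) φ = U.deriv x φ + U.deriv y φ :=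
  map_add (mfderiv 𝓘(ℝ, E) 𝓘(ℝ, H) (U.orbit φ) (1 : G)) x y

lemma deriv_smul_dir (U : UnitaryRep G H) (r : ℝ) (x : GroupLieAlgebra 𝓘(ℝ, E) G) (φ : H) :
    U.deriv (r • x) φ = r • U.deriv x φ :=
  map_smul (mfderiv 𝓘(ℝ, E) 𝓘(ℝ, H) (U.orbit φ) (1 : G)) r x

/-- The operator `dU(x)` on the space of smooth vectors, for `x` in the Lie algebra of `G`. -/
def dOp [LieGroup 𝓘(ℝ, E) ∞ G] (U : UnitaryRep G H) (x : GroupLieAlgebra 𝓘(ℝ, E) G) :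
    Module.End ℂ (U.smoothVectors E) where
  toFun φ := ⟨U.deriv x φ, U.deriv_mem φ.2 x⟩
  map_add' φ ψ := Subtype.ext (U.deriv_add_vec φ.2 ψ.2 x)
  map_smul' a φ := Subtype.ext (U.deriv_smul_vec φ.2 a x)

variable [FiniteDimensional ℝ E] [LieGroup 𝓘(ℝ, E) ∞ G]

attribute [local instance] LieRing.ofAssociativeRing

instance instCompleteModel : CompleteSpace E := FiniteDimensional.complete ℝ E

/-- `dU` as a representation of the real Lie algebra of `G` on the smooth vectors. -/
def dLie (U : UnitaryRep G H) :
    GroupLieAlgebra 𝓘(ℝ, E) G →ₗ⁅ℝ⁆ Module.End ℂ (U.smoothVectors E) where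
  toFun := U.dOp
  map_add' x y := LinearMap.ext fun φ => Subtype.ext (U.deriv_add_dir x y φ)
  map_smul' r x := LinearMap.ext fun φ => Subtype.ext (U.deriv_smul_dir r x φ)
  map_lie' {x y} := LinearMap.ext fun φ => Subtype.ext (U.deriv_lie φ.2 x y)

/-- The complex linear extension of `dU` to the complexified Lie algebra. -/
def dLieComplex (U : UnitaryRep G H) :
    (ℂ ⊗[ℝ] GroupLieAlgebra 𝓘(ℝ, E) G) →ₗ⁅ℂ⁆ Module.End ℂ (U.smoothVectors E) where
  toLinearMap := TensorProduct.AlgebraTensorModule.lift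
    ((LinearMap.toSpanSingleton ℂ _ (U.dLie (E := E) : _ →ₗ[ℝ] _)))
  map_lie' {x y} := by
    simp only [AddHom.toFun_eq_coe, LinearMap.coe_toAddHom]
    induction x using TensorProduct.induction_on with
    | zero => simp
    | add x x' hx hx' => rw [add_lie, map_add, map_add, add_lie, hx, hx']
    | tmul a v =>
      induction y using TensorProduct.induction_on with
      | zero => simp
      | add y y' hy hy' => rw [lie_add, map_add, map_add, lie_add, hy, hy']
      | tmul b w =>
        rw [LieAlgebra.ExtendScalars.bracket_tmul]
        change (a * b) • U.dLie ⁅v, w⁆ = ⁅a • U.dLie v, b • U.dLie w⁆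
        rw [LieHom.map_lie, LieRing.of_associative_ring_bracket,
          LieRing.of_associative_ring_bracket, smul_mul_smul_comm, smul_mul_smul_comm,
          mul_comm b a, smul_sub]

/-- The (complex) universal enveloping algebra of the Lie algebra of `G`. -/
abbrev Enveloping (E G : Type*) [NormedAddCommGroup E] [NormedSpace ℝ E] [FiniteDimensional ℝ E]
    [TopologicalSpace G] [ChartedSpace E G] [Group G] [LieGroup 𝓘(ℝ, E) ∞ G] : Type _ :=
  UniversalEnvelopingAlgebra ℂ (ℂ ⊗[ℝ] GroupLieAlgebra 𝓘(ℝ, E) G)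

/-- The infinitesimal representation `dU` of the enveloping algebra on the smooth vectors. -/
def dEnv (U : UnitaryRep G H) : Enveloping E G →ₐ[ℂ] Module.End ℂ (U.smoothVectors E) :=
  UniversalEnvelopingAlgebra.lift ℂ U.dLieComplex

/-- The operator algebra `dU(𝓔(𝓖))` on the space of smooth vectors. -/
def envAlgebra (E : Type*) [NormedAddCommGroup E] [NormedSpace ℝ E] [FiniteDimensional ℝ E]
    [ChartedSpace E G] [LieGroup 𝓘(ℝ, E) ∞ G] (U : UnitaryRep G H) :
    Subalgebra ℂ (Module.End ℂ (U.smoothVectors E)) :=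
  (U.dEnv (E := E)).range

/-- `dU(𝓔(𝓖))` contains the operators `dU(x)`, `x` in the Lie algebra. -/
lemma dOp_mem_envAlgebra (U : UnitaryRep G H) (x : GroupLieAlgebra 𝓘(ℝ, E) G) :
    U.dOp x ∈ U.envAlgebra E := by
  refine ⟨UniversalEnvelopingAlgebra.ι ℂ
    (L := ℂ ⊗[ℝ] GroupLieAlgebra 𝓘(ℝ, E) G) ((1 : ℂ) ⊗ₜ[ℝ] x), ?_⟩
  change UniversalEnvelopingAlgebra.lift ℂ (U.dLieComplex (E := E)) _ = _
  rw [UniversalEnvelopingAlgebra.lift_ι_apply]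
  change (1 : ℂ) • U.dOp x = _
  rw [one_smul]

end UnitaryRep

/-! ### Trace class operators -/

section TraceClass

variable {H : Type*} [NormedAddCommGroup H] [InnerProductSpace ℂ H] [CompleteSpace H]

/-- An orthonormal basis of `H`. -/
def onb (H : Type*) [NormedAddCommGroup H] [InnerProductSpace ℂ H] [CompleteSpace H] :
    HilbertBasis (exists_hilbertBasis ℂ H).choose ℂ H :=
  (exists_hilbertBasis ℂ H).choose_spec.choose

/-- The trace `∑ₙ ⟨eₙ, T eₙ⟩`. For a trace class operator the sum converges absolutely and does not
depend on the orthonormal basis. -/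
def trace (T : H →ₗ[ℂ] H) : ℂ :=
  ∑' i, ⟪onb H i, T (onb H i)⟫_ℂ

/-- A bounded operator `T` is trace class if `Tr |T| < ∞`, where `|T| = √(T* T)`. -/
def IsTraceClass (T : H →L[ℂ] H) : Prop :=
  Summable fun i => ⟪onb H i, CFC.abs T (onb H i)⟫_ℂ

end TraceClass

/-! ### States on an algebra of operators with a common invariant domain -/

section States

variable {H : Type*} [NormedAddCommGroup H] [InnerProductSpace ℂ H] [CompleteSpace H]
  {D : Submodule ℂ H}

/-- The product `A T`, for `A : D → D` and a bounded operator `T` with range in `D`. -/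
def prodOp (A : Module.End ℂ D) (T : H →L[ℂ] H) (hT : ∀ x, T x ∈ D) : H →ₗ[ℂ] H :=
  D.subtype ∘ₗ A ∘ₗ (T : H →ₗ[ℂ] H).codRestrict D hT

/-- An everywhere defined linear operator which is bounded and trace class. -/
def IsTraceClassMap (S : H →ₗ[ℂ] H) : Prop :=
  ∃ B : H →L[ℂ] H, (B : H →ₗ[ℂ] H) = S ∧ IsTraceClass B

/-- The set `𝓣₁(M)`: trace class operators `T` such that `T` and `T*` map `H` into `D` and
`A T`, `A T*` are trace class for all `A ∈ M`. -/
structure MemTraceClassOn (M : Subalgebra ℂ (Module.End ℂ D)) (T : H →L[ℂ] H) : Prop where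
  traceClass : IsTraceClass T
  range_mem : ∀ x, T x ∈ D
  adjoint_range_mem : ∀ x, (ContinuousLinearMap.adjoint T) x ∈ D
  mul_traceClass : ∀ A ∈ M, IsTraceClassMap (prodOp A T range_mem)
  mul_adjoint_traceClass : ∀ A ∈ M,
    IsTraceClassMap (prodOp A (ContinuousLinearMap.adjoint T) adjoint_range_mem)

/-- The state space of `M`: the positive operators in `𝓣₁(M)` of trace one. -/
structure StateSpace (M : Subalgebra ℂ (Module.End ℂ D)) where
  /-- the density operator -/
  op : H →L[ℂ] H
  mem : MemTraceClassOn M op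
  pos : op.IsPositive
  trace_eq_one : trace (op : H →ₗ[ℂ] H) = 1

/-- The function `a_Q(ρ) = Tr (A ρ)` on the state space. -/
def aQ {M : Subalgebra ℂ (Module.End ℂ D)} (A : Module.End ℂ D) (ρ : StateSpace M) : ℂ :=
  trace (prodOp A ρ.op ρ.mem.range_mem)

/-- The weak topology on the state space: the coarsest one making all functions
`ρ ↦ Tr (A ρ)`, `A ∈ M`, continuous. -/
instance instTopologicalSpaceStateSpace (M : Subalgebra ℂ (Module.End ℂ D)) :
    TopologicalSpace (StateSpace M) :=
  ⨅ A : M, TopologicalSpace.induced (aQ (A : Module.End ℂ D)) inferInstance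

/-- `A`, viewed as an unbounded operator in `H` with domain `D`. -/
def toPMap (A : Module.End ℂ D) : H →ₗ.[ℂ] H where
  domain := D
  toFun := D.subtype ∘ₗ A

/-- `A` is essentially self-adjoint: densely defined, symmetric, with self-adjoint closure. -/
structure IsEssentiallySelfAdjoint (A : Module.End ℂ D) : Prop where
  dense : Dense (D : Set H)
  symmetric : ∀ φ ψ : D, ⟪((A φ : D) : H), (ψ : H)⟫_ℂ = ⟪(φ : H), ((A ψ : D) : H)⟫_ℂ
  selfAdjoint_closure : IsSelfAdjoint (toPMap A).closure

end States

end QReal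

end

noncomputable section

namespace QReal

open ContinuousLinearMap InnerProductSpace
open scoped ENNReal

set_option linter.unusedSectionVars false

variable {H : Type*} [NormedAddCommGroup H] [InnerProductSpace ℂ H] [CompleteSpace H]

/-! ### Hilbert–Schmidt norm -/

/-! The map ρ ↦ Tr(Aρ) is affine, and segments of states are weakly continuous in their parameter.
Take ρ in `W` and any state σ. For small t > 0 the mixture (1 - t)ρ + tσ is still in `W`, so k = (1
- t)k + t Tr(Aσ), and cancelling t gives Tr(Aσ) = k (`aQ_eq_of_eq_on_open`). Testing on the pure
states of unit vectors in the domain gives ⟨φ, Aφ⟩ = k, and complex polarization turns this into A =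
k (`eq_smul_one_of_inner_eq`).

The analytic work is to show that mixtures are states at all. Trace class is defined by summing ⟨e,
|T|e⟩ over one fixed basis, and |S + T| is not controlled by |S| + |T| as an operator.
`isTraceClass_iff` replaces this by a condition visibly linear in T, using polar decomposition and
the fact that √|T| is Hilbert–Schmidt. -/

lemma hasSum_norm_inner_sq {ι : Type*} (b : HilbertBasis ι ℂ H) (x : H) :
    HasSum (fun i => ‖⟪b i, x⟫_ℂ‖ ^ 2) (‖x‖ ^ 2) := by
  have h := b.hasSum_inner_mul_inner x x
  have h' := Complex.reCLM.hasSum h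
  convert h' using 1
  · funext i
    simp only [Complex.reCLM_apply]
    rw [← inner_conj_symm x (b i), mul_comm, Complex.mul_conj, Complex.ofReal_re,
      Complex.normSq_eq_norm_sq]
  · rw [Complex.reCLM_apply, inner_self_eq_norm_sq_to_K]
    norm_cast

/-- Parseval with values in `ℝ≥0∞`, so that double sums can be exchanged with no summability
condition. -/
lemma enorm_sq_eq_tsum {ι : Type*} (b : HilbertBasis ι ℂ H) (x : H) :
    ‖x‖ₑ ^ 2 = ∑' i, ‖⟪b i, x⟫_ℂ‖ₑ ^ 2 := by
  have h := hasSum_norm_inner_sq b x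
  have h2 := ENNReal.ofReal_tsum_of_nonneg (fun i => sq_nonneg ‖⟪b i, x⟫_ℂ‖) h.summable
  rw [h.tsum_eq] at h2
  simpa only [ENNReal.ofReal_pow (norm_nonneg _), ofReal_norm] using h2

/-- The square of the Hilbert–Schmidt norm. -/
def hsSq (B : H →L[ℂ] H) : ℝ≥0∞ := ∑' i, ‖B (onb H i)‖ₑ ^ 2

/-- By Parseval both sides are the double sum of |⟨e_j, B e_i⟩|², taken in the two orders. -/
lemma hsSq_adjoint (B : H →L[ℂ] H) : hsSq (adjoint B) = hsSq B := by
  simp only [hsSq, enorm_sq_eq_tsum (onb H)]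
  rw [ENNReal.tsum_comm]
  refine tsum_congr fun i => tsum_congr fun j => ?_
  rw [adjoint_inner_right, ← enorm_norm ⟪B _, _⟫_ℂ, norm_inner_symm, enorm_norm]

lemma hsSq_comp_le_left (V B : H →L[ℂ] H) : hsSq (V * B) ≤ ‖V‖ₑ ^ 2 * hsSq B := by
  simp only [hsSq, ← ENNReal.tsum_mul_left, ← mul_pow]
  gcongr with i
  exact V.le_opENorm _

/-- A factor on the left is estimated term by term; a factor on the right is moved to the left by
taking adjoints. -/
lemma hsSq_comp_lt_top {B : H →L[ℂ] H} (hB : hsSq B < ⊤) (V : H →L[ℂ] H) :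
    hsSq (B * V) < ⊤ := by
  rw [← hsSq_adjoint, show adjoint (B * V) = adjoint V * adjoint B from adjoint_comp B V]
  refine (hsSq_comp_le_left _ _).trans_lt (ENNReal.mul_lt_top ?_ (by rwa [hsSq_adjoint]))
  exact ENNReal.pow_lt_top enorm_lt_top

lemma summable_norm_sq {B : H →L[ℂ] H} (hB : hsSq B < ⊤) :
    Summable fun i => ‖B (onb H i)‖ ^ 2 := by
  have h := ENNReal.summable_toReal hB.ne
  simpa using h

lemma hsSq_lt_top {B : H →L[ℂ] H} (hB : Summable fun i => ‖B (onb H i)‖ ^ 2) :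
    hsSq B < ⊤ := by
  have h := ENNReal.ofReal_tsum_of_nonneg (fun i => sq_nonneg ‖B (onb H i)‖) hB
  simp only [ENNReal.ofReal_pow (norm_nonneg _), ofReal_norm] at h
  rw [hsSq, ← h]
  exact ENNReal.ofReal_lt_top

lemma summable_inner_of_hsSq {B C : H →L[ℂ] H} (hB : hsSq B < ⊤) (hC : hsSq C < ⊤) :
    Summable fun i => ⟪B (onb H i), C (onb H i)⟫_ℂ := by
  refine Summable.of_norm_bounded ((summable_norm_sq hB).add (summable_norm_sq hC)) fun i => ?_
  refine (norm_inner_le_norm _ _).trans ?_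
  nlinarith [sq_nonneg (‖B (onb H i)‖ - ‖C (onb H i)‖), sq_nonneg ‖B (onb H i)‖,
    sq_nonneg ‖C (onb H i)‖]

/-! ### Polar decomposition -/

/-- Since |T|² = T*T, both squared norms equal ⟨x, T*Tx⟩. -/
lemma norm_abs_apply (T : H →L[ℂ] H) (x : H) : ‖CFC.abs T x‖ = ‖T x‖ := by
  have hs : adjoint (CFC.abs T) = CFC.abs T := (CFC.abs_nonneg T).isSelfAdjoint
  have h : CFC.abs T (CFC.abs T x) = adjoint T (T x) :=
    congrArg (fun S : H →L[ℂ] H => S x) (CFC.abs_mul_abs T)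
  have h2 : ⟪CFC.abs T x, CFC.abs T x⟫_ℂ = ⟪T x, T x⟫_ℂ := by
    rw [← adjoint_inner_right, hs, h, adjoint_inner_right]
  rw [inner_self_eq_norm_sq_to_K, inner_self_eq_norm_sq_to_K] at h2
  have h3 : ‖CFC.abs T x‖ ^ 2 = ‖T x‖ ^ 2 := by exact_mod_cast h2
  exact (pow_left_inj₀ (norm_nonneg _) (norm_nonneg _) two_ne_zero).1 h3

/-- If `‖T x‖ = ‖P x‖` for all `x`, then `T` factors through `P` by a contraction. -/
lemma exists_contraction_mul_eq {P T : H →L[ℂ] H} (h : ∀ x, ‖T x‖ = ‖P x‖) :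
    ∃ V : H →L[ℂ] H, ‖V‖ ≤ 1 ∧ V * P = T := by
  -- Px ↦ Tx is well defined and isometric on the range of `P`. It extends to the closure `K`, and
  -- the orthogonal projection onto `K` makes it zero on the complement.
  let K := (LinearMap.range (P : H →ₗ[ℂ] H)).topologicalClosure
  have : CompleteSpace K := (Submodule.isClosed_topologicalClosure _).completeSpace_coe
  have hmem : ∀ x, P x ∈ K := fun x =>
    Submodule.le_topologicalClosure _ (LinearMap.mem_range_self (P : H →ₗ[ℂ] H) x)
  let e : H →ₗ[ℂ] K := (P : H →ₗ[ℂ] H).codRestrict K hmem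
  have hd : DenseRange e := by
    intro y
    rw [closure_subtype]
    refine closure_mono ?_ y.2
    rintro _ ⟨x, rfl⟩
    exact ⟨e x, ⟨x, rfl⟩, rfl⟩
  have hn : ∀ x, ‖(T : H →ₗ[ℂ] H) x‖ ≤ 1 * ‖e x‖ := fun x => by
    rw [one_mul]
    exact (h x).le
  refine ⟨((T : H →ₗ[ℂ] H).extendOfNorm e).comp K.orthogonalProjectionOnto, ?_, ?_⟩
  · refine (opNorm_comp_le _ _).trans ?_
    exact mul_le_one₀ (LinearMap.opNorm_extendOfNorm_le hd zero_le_one hn) (norm_nonneg _)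
      K.orthogonalProjectionOnto_norm_le
  · ext x
    have h1 : K.orthogonalProjectionOnto (P x) = e x :=
      Submodule.orthogonalProjectionOnto_mem_subspace_eq_self (e x)
    change (T : H →ₗ[ℂ] H).extendOfNorm e (K.orthogonalProjectionOnto (P x)) = T x
    rw [h1]
    exact LinearMap.extendOfNorm_eq hd ⟨1, hn⟩ x

/-- Expanding, ‖V*Vw - w‖² = ‖V*Vw‖² - 2‖Vw‖² + ‖w‖², which is at most 0 because ‖V*Vw‖ ≤ ‖Vw‖ =
‖w‖. -/
lemma adjoint_apply_apply_of_norm_eq {V : H →L[ℂ] H} (hV : ‖V‖ ≤ 1) {w : H}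
    (hw : ‖V w‖ = ‖w‖) : adjoint V (V w) = w := by
  have h1 : ‖adjoint V (V w)‖ ≤ ‖w‖ := by
    have h := (adjoint V).le_opNorm (V w)
    rw [LinearIsometryEquiv.norm_map, hw] at h
    nlinarith [norm_nonneg w]
  have h2 := norm_sub_sq (𝕜 := ℂ) (adjoint V (V w)) w
  rw [adjoint_inner_left, inner_self_eq_norm_sq, hw] at h2
  rw [← sub_eq_zero, ← norm_eq_zero, ← sq_eq_zero_iff]
  nlinarith [norm_nonneg (adjoint V (V w)), sq_nonneg ‖adjoint V (V w) - w‖]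

/-- The contraction with V|T| = T preserves norms on the range of |T|, so V* inverts it there. -/
lemma exists_polar (T : H →L[ℂ] H) :
    ∃ V : H →L[ℂ] H, V * CFC.abs T = T ∧ adjoint V * T = CFC.abs T := by
  obtain ⟨V, hV, h⟩ := exists_contraction_mul_eq (fun x => (norm_abs_apply T x).symm)
  refine ⟨V, h, ?_⟩
  ext x
  have hx : V (CFC.abs T x) = T x := congrArg (fun S : H →L[ℂ] H => S x) h
  change adjoint V (T x) = _
  rw [← hx]
  exact adjoint_apply_apply_of_norm_eq hV (by rw [hx, norm_abs_apply])

/-! ### Trace class operators form a vector space -/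

/-- Write T = V₀R² with R = √|T|. If Tr|T| is finite then R is Hilbert–Schmidt, and ⟨Ve, Te⟩ =
⟨RV₀*Ve, Re⟩ pairs two Hilbert–Schmidt operators. Conversely, V = V₀ recovers ⟨e, |T|e⟩, because
V₀*T = |T|. -/
lemma isTraceClass_iff {T : H →L[ℂ] H} :
    IsTraceClass T ↔ ∀ V : H →L[ℂ] H, Summable fun i => ⟪V (onb H i), T (onb H i)⟫_ℂ := by
  obtain ⟨V₀, h1, h2⟩ := exists_polar T
  constructor
  · intro hT V
    let R : H →L[ℂ] H := CFC.sqrt (CFC.abs T)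
    have hRs : adjoint R = R := (CFC.sqrt_nonneg (CFC.abs T)).isSelfAdjoint
    have hRR : R * R = CFC.abs T := CFC.sqrt_mul_sqrt_self _ (CFC.abs_nonneg T)
    have hin : ∀ x y : H, ⟪x, CFC.abs T y⟫_ℂ = ⟪R x, R y⟫_ℂ := fun x y => by
      rw [← hRR, ← adjoint_inner_right, hRs]
      rfl
    have hR : hsSq R < ⊤ := by
      refine hsSq_lt_top ?_
      have h := Complex.reCLM.summable hT
      refine h.congr fun i => ?_
      rw [Complex.reCLM_apply, hin, inner_self_eq_norm_sq_to_K]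
      norm_cast
    refine (summable_inner_of_hsSq (hsSq_comp_lt_top hR (adjoint V₀ * V)) hR).congr fun i => ?_
    have hx : T (onb H i) = V₀ (CFC.abs T (onb H i)) :=
      congrArg (fun S : H →L[ℂ] H => S (onb H i)) h1.symm
    rw [hx, ← adjoint_inner_left V₀, hin]
    rfl
  · intro h
    refine (h V₀).congr fun i => ?_
    rw [← h2, ← adjoint_inner_right]
    rfl

lemma IsTraceClass.add {S T : H →L[ℂ] H} (hS : IsTraceClass S) (hT : IsTraceClass T) :
    IsTraceClass (S + T) := by
  rw [isTraceClass_iff] at *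
  intro V
  simpa only [add_apply, inner_add_right] using (hS V).add (hT V)

lemma IsTraceClass.smul {T : H →L[ℂ] H} (hT : IsTraceClass T) (c : ℂ) :
    IsTraceClass (c • T) := by
  rw [isTraceClass_iff] at *
  intro V
  simpa only [smul_apply, inner_smul_right] using (hT V).mul_left c

/-- The series is the Parseval expansion of ⟨y, V*x⟩. -/
lemma isTraceClass_rankOne (x y : H) : IsTraceClass (rankOne ℂ x y) := by
  rw [isTraceClass_iff]
  intro V
  refine ((onb H).summable_inner_mul_inner y (adjoint V x)).congr fun i => ?_
  rw [inner_right_rankOne_apply, adjoint_inner_right, mul_comm]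

lemma IsTraceClass.summable {T : H →L[ℂ] H} (hT : IsTraceClass T) :
    Summable fun i => ⟪onb H i, T (onb H i)⟫_ℂ :=
  isTraceClass_iff.1 hT 1

/-! ### Linearity of the trace -/

lemma IsTraceClassMap.add {S T : H →ₗ[ℂ] H} (hS : IsTraceClassMap S) (hT : IsTraceClassMap T) :
    IsTraceClassMap (S + T) := by
  obtain ⟨B, rfl, hB⟩ := hS
  obtain ⟨C, rfl, hC⟩ := hT
  exact ⟨B + C, rfl, hB.add hC⟩

lemma IsTraceClassMap.smul {T : H →ₗ[ℂ] H} (hT : IsTraceClassMap T) (c : ℂ) :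
    IsTraceClassMap (c • T) := by
  obtain ⟨B, rfl, hB⟩ := hT
  exact ⟨c • B, rfl, hB.smul c⟩

lemma trace_add {S T : H →ₗ[ℂ] H} (hS : IsTraceClassMap S) (hT : IsTraceClassMap T) :
    trace (S + T) = trace S + trace T := by
  obtain ⟨B, rfl, hB⟩ := hS
  obtain ⟨C, rfl, hC⟩ := hT
  simp only [trace, LinearMap.add_apply, inner_add_right]
  exact hB.summable.tsum_add hC.summable

lemma trace_smul (c : ℂ) (T : H →ₗ[ℂ] H) : trace (c • T) = c * trace T := by
  simp only [trace, LinearMap.smul_apply, inner_smul_right]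
  exact tsum_mul_left

lemma trace_rankOne (x y : H) : trace (rankOne ℂ x y : H →ₗ[ℂ] H) = ⟪y, x⟫_ℂ := by
  rw [← (onb H).tsum_inner_mul_inner y x]
  refine tsum_congr fun i => ?_
  rw [coe_coe, inner_right_rankOne_apply, mul_comm]

/-! ### Mixtures and pure states -/

section States

variable {D : Submodule ℂ H} {M : Subalgebra ℂ (Module.End ℂ D)}

lemma MemTraceClassOn.add {S T : H →L[ℂ] H} (hS : MemTraceClassOn M S)
    (hT : MemTraceClassOn M T) : MemTraceClassOn M (S + T) where
  traceClass := hS.traceClass.add hT.traceClass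
  range_mem x := D.add_mem (hS.range_mem x) (hT.range_mem x)
  adjoint_range_mem x := by
    rw [map_add]
    exact D.add_mem (hS.adjoint_range_mem x) (hT.adjoint_range_mem x)
  mul_traceClass A hA := by
    convert (hS.mul_traceClass A hA).add (hT.mul_traceClass A hA) using 1
    ext x
    exact congrArg D.subtype
      (A.map_add ⟨S x, hS.range_mem x⟩ ⟨T x, hT.range_mem x⟩)
  mul_adjoint_traceClass A hA := by
    convert (hS.mul_adjoint_traceClass A hA).add (hT.mul_adjoint_traceClass A hA) using 1
    ext x
    simp only [map_add]
    exact congrArg D.subtype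
      (A.map_add ⟨adjoint S x, hS.adjoint_range_mem x⟩ ⟨adjoint T x, hT.adjoint_range_mem x⟩)

lemma MemTraceClassOn.smul {T : H →L[ℂ] H} (hT : MemTraceClassOn M T) (c : ℂ) :
    MemTraceClassOn M (c • T) where
  traceClass := hT.traceClass.smul c
  range_mem x := D.smul_mem c (hT.range_mem x)
  adjoint_range_mem x := by
    rw [map_smulₛₗ]
    exact D.smul_mem _ (hT.adjoint_range_mem x)
  mul_traceClass A hA := by
    convert (hT.mul_traceClass A hA).smul c using 1
    ext x
    exact congrArg D.subtype (A.map_smul c ⟨T x, hT.range_mem x⟩)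
  mul_adjoint_traceClass A hA := by
    convert (hT.mul_adjoint_traceClass A hA).smul (starRingEnd ℂ c) using 1
    ext x
    simp only [map_smulₛₗ]
    exact congrArg D.subtype
      (A.map_smul (starRingEnd ℂ c) ⟨adjoint T x, hT.adjoint_range_mem x⟩)

lemma prodOp_add (A : Module.End ℂ D) {S T : H →L[ℂ] H} (hS : ∀ x, S x ∈ D) (hT : ∀ x, T x ∈ D)
    (hST : ∀ x, (S + T) x ∈ D) : prodOp A (S + T) hST = prodOp A S hS + prodOp A T hT :=
  LinearMap.ext fun x => congrArg D.subtype (A.map_add ⟨S x, hS x⟩ ⟨T x, hT x⟩)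

lemma prodOp_smul (A : Module.End ℂ D) {T : H →L[ℂ] H} (c : ℂ) (hT : ∀ x, T x ∈ D)
    (hcT : ∀ x, (c • T) x ∈ D) : prodOp A (c • T) hcT = c • prodOp A T hT :=
  LinearMap.ext fun x => congrArg D.subtype (A.map_smul c ⟨T x, hT x⟩)

lemma prodOp_rankOne (A : Module.End ℂ D) (φ : D) (y : H)
    (h : ∀ x, rankOne ℂ (φ : H) y x ∈ D) :
    prodOp A (rankOne ℂ (φ : H) y) h = (rankOne ℂ ((A φ : D) : H) y : H →ₗ[ℂ] H) :=
  LinearMap.ext fun x => congrArg D.subtype (A.map_smul ⟪y, x⟫_ℂ φ)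

/-- The operator is self-adjoint, and multiplying it by A gives |Aφ⟩⟨φ|, again of rank one. -/
lemma memTraceClassOn_rankOne (φ : D) : MemTraceClassOn M (rankOne ℂ (φ : H) (φ : H)) where
  traceClass := isTraceClass_rankOne _ _
  range_mem x := D.smul_mem _ φ.2
  adjoint_range_mem x := by
    rw [adjoint_rankOne]
    exact D.smul_mem _ φ.2
  mul_traceClass A _ := ⟨_, (prodOp_rankOne A φ φ _).symm, isTraceClass_rankOne _ _⟩
  mul_adjoint_traceClass A _ := by
    simp only [adjoint_rankOne]
    exact ⟨_, (prodOp_rankOne A φ φ _).symm, isTraceClass_rankOne _ _⟩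

/-- The state `t ρ + (1 - t) σ`. -/
def StateSpace.mix (ρ σ : StateSpace M) (t : unitInterval) : StateSpace M where
  -- The weight `1 - t` is on `ρ`: the segment starts at `ρ` for `t = 0` and ends at `σ`.
  op := (((1 - t : ℝ) : ℂ)) • ρ.op + ((t : ℝ) : ℂ) • σ.op
  mem := (ρ.mem.smul _).add (σ.mem.smul _)
  pos := by
    refine IsPositive.add (ρ.pos.smul_of_nonneg ?_) (σ.pos.smul_of_nonneg ?_)
    · exact_mod_cast sub_nonneg.2 t.2.2
    · exact_mod_cast t.2.1
  trace_eq_one := by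
    have h1 : IsTraceClassMap ((((1 - t : ℝ) : ℂ)) • (ρ.op : H →ₗ[ℂ] H)) :=
      ⟨_, rfl, ρ.mem.traceClass.smul _⟩
    have h2 : IsTraceClassMap (((t : ℝ) : ℂ) • (σ.op : H →ₗ[ℂ] H)) :=
      ⟨_, rfl, σ.mem.traceClass.smul _⟩
    change trace ((((1 - t : ℝ) : ℂ)) • (ρ.op : H →ₗ[ℂ] H) +
      ((t : ℝ) : ℂ) • (σ.op : H →ₗ[ℂ] H)) = 1
    rw [trace_add h1 h2, trace_smul, trace_smul, ρ.trace_eq_one, σ.trace_eq_one]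
    push_cast
    ring

/-- The pure state of a unit vector in `D`. -/
def pureState (M : Subalgebra ℂ (Module.End ℂ D)) (φ : D) (hφ : ‖(φ : H)‖ = 1) :
    StateSpace M where
  op := rankOne ℂ (φ : H) (φ : H)
  mem := memTraceClassOn_rankOne φ
  pos := isPositive_rankOne_self _
  trace_eq_one := by
    rw [trace_rankOne, inner_self_eq_norm_sq_to_K, hφ]
    simp

lemma aQ_pureState (A : Module.End ℂ D) (φ : D) (hφ : ‖(φ : H)‖ = 1) :
    aQ A (pureState M φ hφ) = ⟪(φ : H), ((A φ : D) : H)⟫_ℂ := by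
  rw [← trace_rankOne]
  exact congrArg trace (prodOp_rankOne A φ φ _)

lemma aQ_mix {A : Module.End ℂ D} (hA : A ∈ M) (ρ σ : StateSpace M) (t : unitInterval) :
    aQ A (ρ.mix σ t) = ((1 - t : ℝ) : ℂ) * aQ A ρ + ((t : ℝ) : ℂ) * aQ A σ := by
  have h1 := ρ.mem.smul ((1 - t : ℝ) : ℂ)
  have h2 := σ.mem.smul ((t : ℝ) : ℂ)
  refine (congrArg trace (prodOp_add A h1.range_mem h2.range_mem _)).trans ?_
  rw [trace_add (h1.mul_traceClass A hA) (h2.mul_traceClass A hA),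
    prodOp_smul A _ ρ.mem.range_mem, prodOp_smul A _ σ.mem.range_mem, trace_smul, trace_smul]
  rfl

/-- The weak topology is initial for the functions `aQ A`, and each of these is affine in `t` along
the segment. -/
lemma continuous_mix (ρ σ : StateSpace M) : Continuous (ρ.mix σ) := by
  refine continuous_iInf_rng.2 fun A => continuous_induced_rng.2 ?_
  have h : aQ (A : Module.End ℂ D) ∘ ρ.mix σ = fun t : unitInterval =>
      ((1 - t : ℝ) : ℂ) * aQ (A : Module.End ℂ D) ρ +
        ((t : ℝ) : ℂ) * aQ (A : Module.End ℂ D) σ :=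
    funext fun t => aQ_mix A.2 ρ σ t
  rw [h]
  fun_prop

lemma StateSpace.mix_zero (ρ σ : StateSpace M) : ρ.mix σ 0 = ρ := by
  cases ρ
  simp [StateSpace.mix]

/-- An affine function which is constant on a non-empty open set of states is constant. -/
lemma aQ_eq_of_eq_on_open {A : Module.End ℂ D} (hA : A ∈ M) {W : Set (StateSpace M)}
    (hWopen : IsOpen W) (hWne : W.Nonempty) {k : ℂ} (hk : ∀ ρ ∈ W, aQ A ρ = k)
    (σ : StateSpace M) : aQ A σ = k := by
  obtain ⟨ρ, hρ⟩ := hWne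
  have h0 : ρ.mix σ ⁻¹' W ∈ nhds (0 : unitInterval) :=
    (hWopen.preimage (continuous_mix ρ σ)).mem_nhds (by rwa [mem_preimage, ρ.mix_zero])
  -- The parameters 1/(n + 1) tend to 0 without reaching it, so some mixture with a nonzero weight
  -- on `σ` lies in `W`.
  have hlim : Filter.Tendsto (fun n : ℕ => (⟨1 / ((n : ℝ) + 1), by positivity, by
      rw [div_le_one (by positivity)]; linarith [n.cast_nonneg (α := ℝ)]⟩ : unitInterval))
      Filter.atTop (nhds 0) :=
    tendsto_subtype_rng.2 tendsto_one_div_add_atTop_nhds_zero_nat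
  obtain ⟨n, hn⟩ := (hlim.eventually h0).exists
  have h := aQ_mix hA ρ σ ⟨1 / ((n : ℝ) + 1), by positivity, by
      rw [div_le_one (by positivity)]; linarith [n.cast_nonneg (α := ℝ)]⟩
  rw [hk _ hn, hk _ hρ] at h
  have hne : ((n : ℂ) + 1) ≠ 0 := Nat.cast_add_one_ne_zero n
  push_cast at h
  field_simp at h
  linear_combination -h

/-- An operator on `D` whose expectation is `k` in all pure states is `k`. -/
lemma eq_smul_one_of_inner_eq {A : Module.End ℂ D} {k : ℂ}
    (h : ∀ φ : D, ‖(φ : H)‖ = 1 → ⟪(φ : H), ((A φ : D) : H)⟫_ℂ = k) :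
    A = k • (1 : Module.End ℂ D) := by
  -- Polarization: over ℂ, an operator with vanishing quadratic form is zero. This needs no symmetry
  -- of `A` and no completeness of `D`.
  rw [← sub_eq_zero, ← inner_map_self_eq_zero]
  intro φ
  rcases eq_or_ne φ 0 with rfl | hφ
  · simp
  have hn : ‖φ‖ ≠ 0 := norm_ne_zero_iff.2 hφ
  have hn' : (‖φ‖ : ℂ) ≠ 0 := by exact_mod_cast hn
  -- Rescaling to a unit vector gives the homogeneous form ⟨φ, Aφ⟩ = k‖φ‖².
  have h1 := h (((‖φ‖ : ℂ)⁻¹) • φ) (by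
    rw [← Submodule.coe_norm, norm_smul, norm_inv, Complex.norm_real, norm_norm,
      inv_mul_cancel₀ hn])
  have h2 : ⟪φ, A φ⟫_ℂ = k * (‖φ‖ : ℂ) ^ 2 := by
    rw [map_smul, ← Submodule.coe_inner, inner_smul_left, inner_smul_right] at h1
    simp only [map_inv₀, Complex.conj_ofReal] at h1
    field_simp at h1
    linear_combination h1
  have h3 : ⟪φ, A φ - k • φ⟫_ℂ = 0 := by
    rw [inner_sub_right, inner_smul_right, h2, inner_self_eq_norm_sq_to_K]
    simp
  rw [← inner_conj_symm]
  exact (congrArg (starRingEnd ℂ) h3).trans (map_zero _)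

end States

end QReal

end

theorem corollary14
    {E : Type*} [NormedAddCommGroup E] [NormedSpace ℝ E] [FiniteDimensional ℝ E]
    {G : Type*} [TopologicalSpace G] [ChartedSpace E G] [Group G] [LieGroup 𝓘(ℝ, E) ∞ G]
    {H : Type*} [NormedAddCommGroup H] [InnerProductSpace ℂ H] [CompleteSpace H]
    (U : QReal.UnitaryRep G H)
    (A : Module.End ℂ (U.smoothVectors E)) (hA : A ∈ U.envAlgebra E)
    (hsa : QReal.IsEssentiallySelfAdjoint A)
    (W : Set (QReal.StateSpace (U.envAlgebra E))) (hWopen : IsOpen W) (hWne : W.Nonempty)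
    (k : ℝ) (hk : ∀ ρ ∈ W, QReal.aQ A ρ = (k : ℂ)) :
    A = (k : ℂ) • (1 : Module.End ℂ (U.smoothVectors E)) ∧
      ∀ ρ : QReal.StateSpace (U.envAlgebra E), QReal.aQ A ρ = (k : ℂ) := by
  -- Constancy on all states comes first, since the pure states used for the operator identity need
  -- not lie in `W`.
  have hall := QReal.aQ_eq_of_eq_on_open hA hWopen hWne hk
  refine ⟨QReal.eq_smul_one_of_inner_eq fun φ hφ => ?_, hall⟩
  rw [← QReal.aQ_pureState A φ hφ]
  exact hall _
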